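/- Let $G$ be a (finite-dimensional real) Lie group with identity $e$ and Lie algebra $\mathfrak g = T_eG$, equipped with a left-invariant Riemannian metric $\langle\cdot,\cdot\rangle$, and let $\nabla$ be its Levi-Civita connection, with covariant derivative $D_t$ along curves. For $\xi \in \mathfrak g$ let $\phi(\xi)$ be the left-invariant vector field on $G$ with $\phi(\xi)(e)=\xi$, and define $\nabla^{\mathfrak g}_\xi\eta := (\nabla_{\phi(\xi)}\phi(\eta))(e)$ for $\xi,\eta\in\mathfrak g$. Write $\xi^\flat := \langle \xi,\cdot\rangle \in \mathfrak g^*$ and $(\mathrm{ad}^*_\xi\alpha)(\eta) := \alpha([\xi,\eta])$ for $\alpha\in\mathfrak g^*$. Let $a<b$, and let $g:[a,b]\to G$ be a geodesic, that is, a smooth curve with $D_t\dot g = 0$ on $[a,b]$. Let $\xi := g^{-1}\dot g : [a,b]\to\mathfrak g$, that is, $\xi(t)$ is the push-forward of $\dot g(t)$ by left translation by $g(t)^{-1}$. Then $\xi$ is differentiable on $[a,b]$ and satisfies the Euler–Poincaré equation $$\dot\xi + \nabla^{\mathfrak g}_{\xi}\xi = 0 \quad\text{on } [a,b],$$ equivalently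 $$\dot\xi^\flat = \mathrm{ad}^*_\xi\,\xi^\flat \quad\text{on } [a,b].$$ The equivalence is pointwise: for all $x,v\in\mathfrak g$ one has $v+\nabla^{\mathfrak g}_x x=0$ if and only if $v^\flat=\mathrm{ad}^*_x x^\flat$. -/

import Mathlib

open Set Bundle
open scoped Manifold ContDiff

noncomputable section

namespace EulerPoincare

section Curves

variable {E : Type*} [NormedAddCommGroup E] [NormedSpace ℝ E]
  {H : Type*} [TopologicalSpace H] (I : ModelWithCorners ℝ E H)
  {M : Type*} [TopologicalSpace M] [ChartedSpace H M]

/-- The velocity `γ̇(t)` of a curve `γ : [a, b] → M` (one-sided at the end points). -/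
def velocity (a b : ℝ) (γ : ℝ → M) (t : ℝ) : TangentSpace I (γ t) :=
  mfderivWithin 𝓘(ℝ, ℝ) I γ (Icc a b) t (1 : ℝ)

variable [IsManifold I 1 M]

/-- The covariant derivative `D_t X` along `γ : [a, b] → M` of a vector field `X` along `γ`,
for an affine connection `cov` (recall that `cov σ x v` is `∇_v σ` at the point `x`).

At a time `t`, let `e` be the chart trivialization of `TM` around `γ t`, and let
`E_v := e.symm · v` be the local vector field with constant coordinate vector `v : E`.
If `x s : E` is the coordinate vector of `X s`, so that `X s = E_{x s} (γ s)` for `s` close to `t`,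
then `D_t X (t) = E_{x' t} (γ t) + ∇_{γ̇ t} E_{x t}`; in coordinates, this is
`(D_t X)^k = ẋ^k + Γ^k_{ij} γ̇^i x^j`. -/
def covDerivAlong (cov : CovariantDerivative I E (TangentSpace I : M → Type _))
    (a b : ℝ) (γ : ℝ → M) (X : ∀ t, TangentSpace I (γ t)) (t : ℝ) : TangentSpace I (γ t) :=
  let e := trivializationAt E (TangentSpace I : M → Type _) (γ t)
  let x : ℝ → E := fun s ↦ (e ⟨γ s, X s⟩).2
  e.symm (γ t) (derivWithin x (Icc a b) t) +
    cov (fun p ↦ e.symm p (x t)) (γ t) (velocity I a b γ t)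

/-- A geodesic `γ : [a, b] → M` of an affine connection: a smooth curve with `D_t γ̇ = 0`. -/
structure IsGeodesicOn (cov : CovariantDerivative I E (TangentSpace I : M → Type _))
    (a b : ℝ) (γ : ℝ → M) : Prop where
  contMDiffOn : ContMDiffOn 𝓘(ℝ, ℝ) I ∞ γ (Icc a b)
  covDerivAlong_velocity : ∀ t ∈ Icc a b, covDerivAlong I cov a b γ (velocity I a b γ) t = 0

end Curves

section LeviCivita

variable {E : Type*} [NormedAddCommGroup E] [NormedSpace ℝ E] [FiniteDimensional ℝ E]
  {H : Type*} [TopologicalSpace H] {I : ModelWithCorners ℝ E H}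
  {M : Type*} [TopologicalSpace M] [ChartedSpace H M] [IsManifold I ∞ M]
  [RiemannianBundle (fun x : M ↦ TangentSpace I x)]
  [IsContMDiffRiemannianBundle I ∞ E (fun x : M ↦ TangentSpace I x)]

/-- The Levi-Civita connection of a Riemannian manifold: the affine connection which is
torsion-free and compatible with the metric. -/
structure IsLeviCivita (cov : CovariantDerivative I E (TangentSpace I : M → Type _)) : Prop where
  torsion_eq_zero : haveI : CompleteSpace E := FiniteDimensional.complete ℝ E
    cov.torsion = 0
  isMetricCompatible : ∀ (X σ τ : ∀ x : M, TangentSpace I x) (x : M),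
    MDiffAt (T% X) x → MDiffAt (T% σ) x → MDiffAt (T% τ) x →
      mvfderiv I (fun p ↦ inner ℝ (σ p) (τ p)) x (X x) =
        inner ℝ (cov σ x (X x)) (τ x) + inner ℝ (σ x) (cov τ x (X x))

end LeviCivita

section LieGroup

variable {E : Type*} [NormedAddCommGroup E] [NormedSpace ℝ E]
  {H : Type*} [TopologicalSpace H] (I : ModelWithCorners ℝ E H)
  {G : Type*} [TopologicalSpace G] [ChartedSpace H G] [Group G]

/-- The left-trivialized velocity `ξ(t) = g(t)⁻¹ ġ(t) ∈ 𝔤 = T_e G` of a curve `g : [a, b] → G`: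
the push-forward of `ġ(t)` by the left translation by `g(t)⁻¹`. -/
def leftVelocity (a b : ℝ) (g : ℝ → G) (t : ℝ) : GroupLieAlgebra I G :=
  mfderiv I I (fun h : G ↦ (g t)⁻¹ * h) (g t) (velocity I a b g t)

variable (G) in
/-- A Riemannian metric on `G` is left-invariant if all the left translations preserve it. -/
def IsLeftInvariantMetric [RiemannianBundle (fun x : G ↦ TangentSpace I x)] : Prop :=
  ∀ (g h : G) (v w : TangentSpace I h),
    inner ℝ (mfderiv I I (fun x : G ↦ g * x) h v : TangentSpace I (g * h))
      (mfderiv I I (fun x : G ↦ g * x) h w : TangentSpace I (g * h)) = inner ℝ v w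

variable {I}

/-- The `𝔤`-connection `∇^𝔤_ξ η := (∇_{φ(ξ)} φ(η))(e)`, where `φ(ξ)` is the left-invariant vector
field with value `ξ` at the identity `e`. -/
def lieConnection [LieGroup I ∞ G] (cov : CovariantDerivative I E (TangentSpace I : G → Type _))
    (ξ η : GroupLieAlgebra I G) : GroupLieAlgebra I G :=
  cov (mulInvariantVectorField η) 1 (mulInvariantVectorField ξ 1)

/-- The flat map `ξ ↦ ξ^♭ = ⟨ξ, ·⟩` from `𝔤` to its dual. -/
def flat [RiemannianBundle (fun x : G ↦ TangentSpace I x)] (ξ : GroupLieAlgebra I G) :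
    Module.Dual ℝ (GroupLieAlgebra I G) :=
  innerₗ (TangentSpace I (1 : G)) ξ

/-- The adjoint operator `ad_ξ η = [ξ, η]` of the Lie algebra of `G`. -/
def adMap [CompleteSpace E] [LieGroup I ∞ G] (ξ : GroupLieAlgebra I G) :
    GroupLieAlgebra I G →ₗ[ℝ] GroupLieAlgebra I G :=
  haveI : LieGroup I (minSmoothness ℝ 3) G := LieGroup.of_le (n := ∞) (by simp; exact ENat.LEInfty.out)
  LieAlgebra.ad ℝ (GroupLieAlgebra I G) ξ

/-- The dual `ad^*_ξ : 𝔤^* → 𝔤^*` of `ad_ξ`, that is `(ad^*_ξ α)(η) = α([ξ, η])`. -/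
def coadMap [CompleteSpace E] [LieGroup I ∞ G] (ξ : GroupLieAlgebra I G) :
    Module.Dual ℝ (GroupLieAlgebra I G) →ₗ[ℝ] Module.Dual ℝ (GroupLieAlgebra I G) :=
  (adMap ξ).dualMap

end LieGroup

end EulerPoincare

end

noncomputable section

namespace EulerPoincare

section LocalFormula

variable {E : Type*} [NormedAddCommGroup E] [NormedSpace ℝ E] [FiniteDimensional ℝ E]
  {H : Type*} [TopologicalSpace H] {I : ModelWithCorners ℝ E H}
  {M : Type*} [TopologicalSpace M] [ChartedSpace H M] [IsManifold I ∞ M]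

omit [FiniteDimensional ℝ E] in
lemma mdifferentiableAt_symm_const (x₀ : M) (c : E) :
    MDiffAt (T% (fun p : M ↦ (trivializationAt E (TangentSpace I : M → Type _) x₀).symm p c))
      x₀ := by
  have hx₀ := FiberBundle.mem_baseSet_trivializationAt E (TangentSpace I : M → Type _) x₀
  rw [(trivializationAt E (TangentSpace I : M → Type _) x₀).mdifferentiableAt_section_iff I _ hx₀]
  refine (mdifferentiableAt_const (c := c)).congr_of_eventuallyEq ?_
  filter_upwards [(trivializationAt E (TangentSpace I : M → Type _) x₀).open_baseSet.mem_nhds hx₀]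
    with p hp
  simp [Trivialization.apply_mk_symm _ hp]

omit [FiniteDimensional ℝ E] in
lemma mdifferentiableAt_sum_smul {ι : Type*} (s : Finset ι) {f : ι → M → ℝ}
    {σ : ι → ∀ p : M, TangentSpace I p} {x : M}
    (hf : ∀ i, MDiffAt (f i) x) (hσ : ∀ i, MDiffAt (T% (σ i)) x) :
    MDiffAt (T% (∑ i ∈ s, f i • σ i)) x := by
  have := MDifferentiableAt.sum_section (s := s) (fun i _ ↦ (hf i).smul_section (hσ i))
  convert! this using 3
  simp

omit [FiniteDimensional ℝ E] in
/-- The Leibniz rule for a linear combination of sections. -/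
lemma cov_sum_smul (cov : CovariantDerivative I E (TangentSpace I : M → Type _)) {ι : Type*}
    (s : Finset ι) {f : ι → M → ℝ} {σ : ι → ∀ p : M, TangentSpace I p} {x : M}
    (hf : ∀ i, MDiffAt (f i) x) (hσ : ∀ i, MDiffAt (T% (σ i)) x) :
    cov (∑ i ∈ s, f i • σ i) x =
      ∑ i ∈ s, (f i x • cov (σ i) x + (mvfderiv I (f i) x).smulRight (σ i x)) := by
  classical
  induction s using Finset.induction_on with
  | empty => simp [cov.isCovariantDerivativeOn.zero (mem_univ x)]
  | insert i s hi ih =>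
    rw [Finset.sum_insert hi, Finset.sum_insert hi, ← ih,
      cov.isCovariantDerivativeOn.add ((hf i).smul_section (hσ i))
        (mdifferentiableAt_sum_smul s hf hσ),
      cov.isCovariantDerivativeOn.leibniz (hσ i) (hf i)]

/-- The local formula `∇_v σ = dσ(v) + Γ(v, σ)` for a covariant derivative in the chart
trivialization of the tangent bundle. -/
lemma cov_eq_symm_mvfderiv_add (cov : CovariantDerivative I E (TangentSpace I : M → Type _))
    {σ : ∀ p : M, TangentSpace I p} {x₀ : M} (hσ : MDiffAt (T% σ) x₀) (v : TangentSpace I x₀) :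
    cov σ x₀ v =
      (trivializationAt E (TangentSpace I : M → Type _) x₀).symm x₀
        (mvfderiv I
          (fun p ↦ (trivializationAt E (TangentSpace I : M → Type _) x₀ ⟨p, σ p⟩).2) x₀ v) +
      cov (fun p ↦ (trivializationAt E (TangentSpace I : M → Type _) x₀).symm p
        (trivializationAt E (TangentSpace I : M → Type _) x₀ ⟨x₀, σ x₀⟩).2) x₀ v := by
  have hsm := mdifferentiableAt_symm_const (I := I) x₀
  set e := trivializationAt E (TangentSpace I : M → Type _) x₀ with he
  have hx₀ : x₀ ∈ e.baseSet :=
    FiberBundle.mem_baseSet_trivializationAt E (TangentSpace I : M → Type _) x₀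
  let b := Module.finBasis ℝ E
  let l : M → E := fun p ↦ (e ⟨p, σ p⟩).2
  let L : Fin (Module.finrank ℝ E) → E →L[ℝ] ℝ := fun i ↦ (b.coord i).toContinuousLinearMap
  let F : Fin (Module.finrank ℝ E) → ∀ p : M, TangentSpace I p := fun i p ↦ e.symm p (b i)
  have hF : ∀ i, MDiffAt (T% (F i)) x₀ := fun i ↦ hsm (b i)
  have hl : MDiffAt l x₀ := (e.mdifferentiableAt_section_iff I σ hx₀).1 hσ
  have hsymm : ∀ (c : E) {p : M}, p ∈ e.baseSet → e.symm p c = ∑ i, L i c • F i p := by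
    intro c p hp
    calc e.symm p c = e.symmₗ ℝ p (∑ i, b.repr c i • b i) := by rw [b.sum_repr, e.coe_symmₗ hp]
      _ = ∑ i, b.repr c i • e.symmₗ ℝ p (b i) := by rw [map_sum]; simp only [map_smul]
      _ = ∑ i, L i c • F i p := by simp [F, L, ← e.coe_symmₗ (R := ℝ) hp]
  have hf : ∀ i, MDiffAt (fun p ↦ L i (l p)) x₀ := fun i ↦
    (L i).differentiableAt.comp_mdifferentiableAt hl
  have hdf : ∀ i, mvfderiv I (fun p ↦ L i (l p)) x₀ v = L i (mvfderiv I l x₀ v) := by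
    intro i
    have := mfderiv_comp_apply x₀ (L i).differentiableAt.mdifferentiableAt hl v
    rw [mfderiv_eq_fderiv, ContinuousLinearMap.fderiv] at this
    exact this
  have h1 : cov σ x₀ = cov (∑ i, (fun p ↦ L i (l p)) • F i) x₀ := by
    refine cov.isCovariantDerivativeOn.congr_of_eventuallyEq hσ
      (mdifferentiableAt_sum_smul _ hf hF) Filter.univ_mem ?_
    filter_upwards [e.open_baseSet.mem_nhds hx₀] with p hp
    have : σ p = e.symm p (l p) := (e.symm_apply_apply_mk hp (σ p)).symm
    rw [this, hsymm _ hp]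
    simp
  have h2 : cov (fun p ↦ e.symm p (l x₀)) x₀ =
      cov (∑ i, (fun _ : M ↦ L i (l x₀)) • F i) x₀ := by
    refine cov.isCovariantDerivativeOn.congr_of_eventuallyEq (hsm _)
      (mdifferentiableAt_sum_smul _ (fun _ ↦ mdifferentiableAt_const) hF) Filter.univ_mem ?_
    filter_upwards [e.open_baseSet.mem_nhds hx₀] with p hp
    rw [hsymm _ hp]
    simp
  change _ = e.symm x₀ (mvfderiv I l x₀ v) + cov (fun p ↦ e.symm p (l x₀)) x₀ v
  rw [h1, h2, cov_sum_smul cov _ hf hF, cov_sum_smul cov _ (fun _ ↦ mdifferentiableAt_const) hF,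
    hsymm _ hx₀]
  simp only [FunLike.coe_sum, Finset.sum_apply, ← Finset.sum_add_distrib]
  refine Finset.sum_congr rfl fun i _ ↦ ?_
  simp [hdf, mvfderiv_const, add_comm]

end LocalFormula

section LieGroup

variable {E : Type*} [NormedAddCommGroup E] [NormedSpace ℝ E]
  {H : Type*} [TopologicalSpace H] {I : ModelWithCorners ℝ E H}
  {G : Type*} [TopologicalSpace G] [ChartedSpace H G] [Group G] [LieGroup I ∞ G]

lemma mfderiv_mul_left_mfderiv_mul_left_inv (g : G) (v : TangentSpace I g) :
    (mulInvariantVectorField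
      (mfderiv I I (fun h : G ↦ g⁻¹ * h) g v : GroupLieAlgebra I G) g : TangentSpace I g) = v := by
  have h1 : MDifferentiableAt I I (fun h : G ↦ g * h) (g⁻¹ * g) :=
    (contMDiff_mul_left (I := I) (n := ∞)).contMDiffAt.mdifferentiableAt (by simp)
  have h2 : MDifferentiableAt I I (fun h : G ↦ g⁻¹ * h) g :=
    (contMDiff_mul_left (I := I) (n := ∞)).contMDiffAt.mdifferentiableAt (by simp)
  have h3 := mfderiv_comp_apply g h1 h2 v
  have h4 : (fun h : G ↦ g * h) ∘ (fun h : G ↦ g⁻¹ * h) = id := by ext; simp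
  rw [h4, mfderiv_id] at h3
  rw [inv_mul_cancel] at h3
  exact h3.symm

lemma velocity_eq_mulInvariantVectorField (a b : ℝ) (g : ℝ → G) (t : ℝ) :
    velocity I a b g t = mulInvariantVectorField (leftVelocity I a b g t) (g t) :=
  (mfderiv_mul_left_mfderiv_mul_left_inv (g t) _).symm

lemma mdifferentiableAt_leftInvariant (v : GroupLieAlgebra I G) (p : G) :
    MDiffAt (T% (mulInvariantVectorField v : ∀ q : G, TangentSpace I q)) p :=
  haveI : LieGroup I (minSmoothness ℝ 3) G :=
    LieGroup.of_le (n := ∞) (by simp; exact ENat.LEInfty.out)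
  mdifferentiableAt_mulInvariantVectorField v

lemma mlieBracket_leftInvariant [CompleteSpace E] (x y : GroupLieAlgebra I G) :
    VectorField.mlieBracket I (mulInvariantVectorField x) (mulInvariantVectorField y) =
      mulInvariantVectorField (adMap x y) :=
  haveI : LieGroup I (minSmoothness ℝ 3) G :=
    LieGroup.of_le (n := ∞) (by simp; exact ENat.LEInfty.out)
  (mulInvariantVector_mlieBracket x y).symm

section Metric

variable [RiemannianBundle (fun x : G ↦ TangentSpace I x)]

omit [LieGroup I ∞ G] in
lemma inner_leftInvariant (hinv : IsLeftInvariantMetric I G) (x y : GroupLieAlgebra I G) (p : G) :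
    inner ℝ (mulInvariantVectorField x p : TangentSpace I p) (mulInvariantVectorField y p) =
      flat x y := by
  have key : ∀ q : G, q = p → ∀ v w : E,
      inner ℝ (show TangentSpace I q from v) (show TangentSpace I q from w) =
        inner ℝ (show TangentSpace I p from v) (show TangentSpace I p from w) := by
    rintro q rfl v w; rfl
  exact (key (p * 1) (mul_one p) _ _).symm.trans (hinv p 1 x y)

variable [FiniteDimensional ℝ E]

/-- The Koszul formula for `∇_X X`, where `X` is left-invariant. -/
lemma inner_cov_leftInvariant (hinv : IsLeftInvariantMetric I G)
    {cov : CovariantDerivative I E (TangentSpace I : G → Type _)} (hcov : IsLeviCivita cov)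
    (x z : GroupLieAlgebra I G) (p : G) :
    haveI : CompleteSpace E := FiniteDimensional.complete ℝ E
    inner ℝ (cov (mulInvariantVectorField x) p (mulInvariantVectorField x p))
      (mulInvariantVectorField z p : TangentSpace I p) =
        - flat x (adMap x z) := by
  have : CompleteSpace E := FiniteDimensional.complete ℝ E
  have hx := mdifferentiableAt_leftInvariant (I := I) x p
  have hz := mdifferentiableAt_leftInvariant (I := I) z p
  have h1 := hcov.isMetricCompatible _ _ _ p hx hx hz
  have h2 := hcov.isMetricCompatible _ _ _ p hz hx hx
  have h3 := cov.torsion_eq_zero_iff.1 hcov.torsion_eq_zero hx hz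
  simp only [inner_leftInvariant hinv, mvfderiv_const, zero_apply] at h1 h2
  rw [real_inner_comm (mulInvariantVectorField x p : TangentSpace I p)] at h2
  rw [mlieBracket_leftInvariant, sub_eq_iff_eq_add] at h3
  rw [h3, inner_add_right, inner_leftInvariant hinv] at h1
  linarith

lemma inner_lieConnection_self (hinv : IsLeftInvariantMetric I G)
    {cov : CovariantDerivative I E (TangentSpace I : G → Type _)} (hcov : IsLeviCivita cov)
    (x z : GroupLieAlgebra I G) :
    haveI : CompleteSpace E := FiniteDimensional.complete ℝ E
    flat (lieConnection cov x x) z =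
      - flat x (adMap x z) := by
  have h1 : ∀ z : GroupLieAlgebra I G, mulInvariantVectorField z (1 : G) = z := by
    intro z
    have : (fun h : G ↦ 1 * h) = id := by ext; simp
    rw [mulInvariantVectorField, this, mfderiv_id]
    rfl
  have := inner_cov_leftInvariant hinv hcov x z 1
  rwa [h1 z] at this

lemma cov_leftInvariant_self (hinv : IsLeftInvariantMetric I G)
    {cov : CovariantDerivative I E (TangentSpace I : G → Type _)} (hcov : IsLeviCivita cov)
    (x : GroupLieAlgebra I G) (p : G) :
    cov (mulInvariantVectorField x) p (mulInvariantVectorField x p) =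
      mulInvariantVectorField (lieConnection cov x x) p := by
  refine ext_inner_right ℝ fun w ↦ ?_
  obtain ⟨z, rfl⟩ : ∃ z : GroupLieAlgebra I G, mulInvariantVectorField z p = w :=
    ⟨_, mfderiv_mul_left_mfderiv_mul_left_inv p w⟩
  rw [inner_cov_leftInvariant hinv hcov, inner_leftInvariant hinv,
    inner_lieConnection_self hinv hcov]

/-- The two forms of the Euler–Poincaré equation are pointwise equivalent. -/
lemma add_lieConnection_eq_zero_iff (hinv : IsLeftInvariantMetric I G)
    {cov : CovariantDerivative I E (TangentSpace I : G → Type _)} (hcov : IsLeviCivita cov)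
    (x v : GroupLieAlgebra I G) :
    haveI : CompleteSpace E := FiniteDimensional.complete ℝ E
    v + lieConnection cov x x = 0 ↔ flat v = coadMap x (flat x) := by
  have hflat : ∀ w : GroupLieAlgebra I G, (∀ z, flat w z = 0) → w = 0 := fun w h ↦
    ext_inner_right (E := TangentSpace I (1 : G)) ℝ fun z ↦ (h z).trans (inner_zero_left z).symm
  have hadd : ∀ z, flat (v + lieConnection cov x x) z = flat v z - flat x (adMap x z) := by
    intro z
    rw [sub_eq_add_neg, ← inner_lieConnection_self hinv hcov, flat, map_add]
    rfl
  constructor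
  · intro h
    ext z
    have := hadd z
    rw [h, flat, map_zero, LinearMap.zero_apply] at this
    exact (sub_eq_zero.1 this.symm)
  · intro h
    refine hflat _ fun z ↦ ?_
    rw [hadd, h]
    exact sub_self _

end Metric

end LieGroup

section Curve

variable {E : Type*} [NormedAddCommGroup E] [NormedSpace ℝ E]
  {H : Type*} [TopologicalSpace H] {I : ModelWithCorners ℝ E H}

lemma contMDiffOn_velocity {M : Type*} [TopologicalSpace M] [ChartedSpace H M] [IsManifold I ∞ M]
    {a b : ℝ} (hab : a < b) {γ : ℝ → M} (hγ : ContMDiffOn 𝓘(ℝ, ℝ) I ∞ γ (Icc a b)) :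
    ContMDiffOn 𝓘(ℝ, ℝ) I.tangent 1
      (fun t ↦ (⟨γ t, velocity I a b γ t⟩ : TangentBundle I M)) (Icc a b) := by
  have h1 := hγ.contMDiffOn_tangentMapWithin (m := 1) (by norm_cast)
    (uniqueDiffOn_Icc hab).uniqueMDiffOn
  have h2 : ContMDiff 𝓘(ℝ, ℝ) 𝓘(ℝ, ℝ).tangent 1
      (fun t : ℝ ↦ (⟨t, (1 : ℝ)⟩ : TangentBundle 𝓘(ℝ, ℝ) ℝ)) :=
    contMDiff_vectorSpace_iff_contDiff.2 contDiff_const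
  exact h1.comp h2.contMDiffOn (fun t ht ↦ ht)

lemma trivializationAt_self_apply {M : Type*} [TopologicalSpace M] [ChartedSpace H M]
    [IsManifold I 1 M] (x : M) (v : TangentSpace I x) :
    (trivializationAt E (TangentSpace I : M → Type _) x ⟨x, v⟩).2 = v :=
  (tangentBundleCore I M).coordChange_self (achart H x) x (mem_chart_source H x) v

variable {G : Type*} [TopologicalSpace G] [ChartedSpace H G] [Group G] [LieGroup I ∞ G]

lemma tangentMap_mul_inv_zero (p : G) (v : TangentSpace I p) :
    tangentMap (I.prod I) I (fun q : G × G ↦ q.1 * q.2)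
      ((equivTangentBundleProd I G I G).symm (⟨p⁻¹, 0⟩, ⟨p, v⟩)) =
        ⟨1, (mfderiv I I (fun h : G ↦ p⁻¹ * h) p v : GroupLieAlgebra I G)⟩ := by
  refine TotalSpace.ext (inv_mul_cancel p) (heq_of_eq ?_)
  have h := mfderiv_prod_eq_add_apply (I := I) (I' := I) (I'' := I) (p := (p⁻¹, p))
    (v := (0, v)) ((contMDiff_mul I ∞).mdifferentiableAt (by simp))
  refine h.trans ?_
  change mfderiv I I (fun z : G ↦ z * p) p⁻¹ 0 + mfderiv I I (fun z : G ↦ p⁻¹ * z) p v = _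
  rw [map_zero, zero_add]

lemma differentiableOn_leftVelocity {a b : ℝ} (hab : a < b) {g : ℝ → G}
    (hg : ContMDiffOn 𝓘(ℝ, ℝ) I ∞ g (Icc a b)) :
    DifferentiableOn ℝ (leftVelocity I a b g) (Icc a b) := by
  intro t ht
  have hV := contMDiffOn_velocity hab hg t ht
  have hinv : ContMDiffWithinAt 𝓘(ℝ, ℝ) I 1 (fun s ↦ (g s)⁻¹) (Icc a b) t :=
    ((hg t ht).inv).of_le (by norm_cast)
  have h0 : ContMDiffWithinAt 𝓘(ℝ, ℝ) I.tangent 1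
      (fun s ↦ (⟨(g s)⁻¹, 0⟩ : TangentBundle I G)) (Icc a b) t :=
    (contMDiff_zeroSection ℝ (TangentSpace I : G → Type _)).contMDiffAt.comp_contMDiffWithinAt t hinv
  have hmul : ContMDiff (I.prod I).tangent I.tangent 1
      (tangentMap (I.prod I) I (fun p : G × G ↦ p.1 * p.2)) :=
    (contMDiff_mul I ∞).contMDiff_tangentMap (m := 1) (by norm_cast)
  have hW := (hmul.comp contMDiff_equivTangentBundleProd_symm).contMDiffAt.comp_contMDiffWithinAt t
    (h0.prodMk hV)
  have hW' : ContMDiffWithinAt 𝓘(ℝ, ℝ) I.tangent 1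
      (fun s ↦ (⟨1, leftVelocity I a b g s⟩ : TangentBundle I G)) (Icc a b) t := by
    convert! hW using 2 with s
    exact (tangentMap_mul_inv_zero _ _).symm
  have h2 := (contMDiffWithinAt_totalSpace.1 hW').2
  simp only [trivializationAt_self_apply] at h2
  exact (contMDiffWithinAt_iff_contDiffWithinAt.1 h2).differentiableWithinAt one_ne_zero

lemma hasDerivWithinAt_clm_comp {f : ℝ → E} {s : Set ℝ} {t : ℝ}
    (hf : DifferentiableWithinAt ℝ f s t) (L : E →L[ℝ] ℝ) :
    HasDerivWithinAt (fun r ↦ L (f r)) (L (derivWithin f s t)) s t :=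
  L.hasFDerivAt.comp_hasDerivWithinAt t hf.hasDerivWithinAt

lemma covDerivAlong_velocity [FiniteDimensional ℝ E]
    (cov : CovariantDerivative I E (TangentSpace I : G → Type _)) {a b : ℝ} (hab : a < b)
    {g : ℝ → G} (hg : ContMDiffOn 𝓘(ℝ, ℝ) I ∞ g (Icc a b)) {t : ℝ} (ht : t ∈ Icc a b) :
    covDerivAlong I cov a b g (velocity I a b g) t =
      mulInvariantVectorField (derivWithin (leftVelocity I a b g) (Icc a b) t) (g t) +
      cov (mulInvariantVectorField (leftVelocity I a b g t)) (g t) (velocity I a b g t) := by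
  set e := trivializationAt E (TangentSpace I : G → Type _) (g t) with he
  have ht₀ : g t ∈ e.baseSet :=
    FiberBundle.mem_baseSet_trivializationAt E (TangentSpace I : G → Type _) (g t)
  set ξ := leftVelocity I a b g
  let β : Module.Basis _ ℝ (GroupLieAlgebra I G) := Module.finBasis ℝ E
  let l : GroupLieAlgebra I G → G → E := fun v p ↦ (e ⟨p, mulInvariantVectorField v p⟩).2
  have hlin : ∀ p ∈ e.baseSet, ∃ D : GroupLieAlgebra I G →ₗ[ℝ] E, ∀ v, D v = l v p := by
    intro p hp
    refine ⟨{ toFun := fun v ↦ e.linearMapAt ℝ p (mulInvariantVectorField v p)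
              map_add' := fun v w ↦ ?_
              map_smul' := fun c v ↦ ?_ }, fun v ↦ ?_⟩
    · rw [mulInvariantVectorField_add, Pi.add_apply, map_add]
    · rw [mulInvariantVectorField_smul, Pi.smul_apply, map_smul]; rfl
    · exact congrFun (e.coe_linearMapAt_of_mem (R := ℝ) hp) _
  have hsum : ∀ p ∈ e.baseSet, ∀ v, l v p = ∑ i, β.coord i v • l (β i) p := by
    intro p hp v
    obtain ⟨D, hD⟩ := hlin p hp
    simp only [← hD]
    conv_lhs => rw [← β.sum_repr v, map_sum]
    exact Finset.sum_congr rfl fun i _ ↦ D.map_smul _ _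
  have hl : ∀ v, MDiffAt (l v) (g t) := fun v ↦
    (e.mdifferentiableAt_section_iff I _ ht₀).1 (mdifferentiableAt_leftInvariant v (g t))
  have hgt : MDifferentiableWithinAt 𝓘(ℝ, ℝ) I g (Icc a b) t :=
    (hg t ht).mdifferentiableWithinAt (by simp)
  have hlg : ∀ v, HasDerivWithinAt (fun s ↦ l v (g s))
      (mvfderiv I (l v) (g t) (velocity I a b g t)) (Icc a b) t := by
    intro v
    have h : HasFDerivWithinAt (fun s ↦ l v (g s))
        ((mvfderiv I (l v) (g t)).comp (show ℝ →L[ℝ] TangentSpace I (g t) from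
          mfderivWithin 𝓘(ℝ, ℝ) I g (Icc a b) t)) (Icc a b) t :=
      ((hl v).hasMFDerivAt.comp_hasMFDerivWithinAt t
        hgt.hasMFDerivWithinAt).hasFDerivWithinAt
    exact h.hasDerivWithinAt
  have hc : ∀ i, HasDerivWithinAt (fun s ↦ β.coord i (ξ s) - β.coord i (ξ t))
      (β.coord i (derivWithin ξ (Icc a b) t)) (Icc a b) t := by
    intro i
    refine HasDerivWithinAt.sub_const _ ?_
    let ζ : ℝ → E := ξ
    have hζ : DifferentiableWithinAt ℝ ζ (Icc a b) t := differentiableOn_leftVelocity hab hg t ht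
    exact hasDerivWithinAt_clm_comp hζ ((Module.finBasis ℝ E).coord i).toContinuousLinearMap
  have hx_eq : ∀ s, g s ∈ e.baseSet → (e ⟨g s, velocity I a b g s⟩).2 =
      l (ξ t) (g s) + ∑ i, (β.coord i (ξ s) - β.coord i (ξ t)) • l (β i) (g s) := by
    intro s hs
    rw [velocity_eq_mulInvariantVectorField]
    change l (ξ s) (g s) = _
    simp only [sub_smul, Finset.sum_sub_distrib]
    rw [← hsum _ hs, ← hsum _ hs]
    abel
  have hx : HasDerivWithinAt (fun s ↦ (e ⟨g s, velocity I a b g s⟩).2)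
      (mvfderiv I (l (ξ t)) (g t) (velocity I a b g t) +
        l (derivWithin ξ (Icc a b) t) (g t)) (Icc a b) t := by
    have h := (hlg (ξ t)).fun_add (HasDerivWithinAt.fun_sum (u := Finset.univ)
      fun i _ ↦ (hc i).fun_smul (hlg (β i)))
    simp only [sub_self, zero_smul, zero_add] at h
    rw [← hsum _ ht₀] at h
    refine h.congr_of_eventuallyEq ?_ (hx_eq t ht₀)
    filter_upwards [hgt.continuousWithinAt (e.open_baseSet.mem_nhds ht₀)] with s hs
    exact hx_eq s hs
  have hv : (e ⟨g t, velocity I a b g t⟩).2 = l (ξ t) (g t) := by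
    rw [velocity_eq_mulInvariantVectorField]
  rw [cov_eq_symm_mvfderiv_add cov (mdifferentiableAt_leftInvariant (ξ t) (g t)), covDerivAlong]
  simp only [← he]
  rw [hx.derivWithin (uniqueDiffOn_Icc hab t ht), hv, ← e.coe_symmₗ (R := ℝ) ht₀, map_add,
    e.coe_symmₗ (R := ℝ) ht₀]
  have : e.symm (g t) (l (derivWithin ξ (Icc a b) t) (g t)) =
      mulInvariantVectorField (derivWithin ξ (Icc a b) t) (g t) :=
    e.symm_apply_apply_mk ht₀ _
  rw [this]
  abel

/-- The left-trivialized velocity of a geodesic satisfies the Euler–Poincaré equation. -/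
lemma IsGeodesicOn.euler_poincare [FiniteDimensional ℝ E]
    [RiemannianBundle (fun x : G ↦ TangentSpace I x)]
    (hinv : IsLeftInvariantMetric I G)
    {cov : CovariantDerivative I E (TangentSpace I : G → Type _)} (hcov : IsLeviCivita cov)
    {a b : ℝ} (hab : a < b) {g : ℝ → G} (hg : IsGeodesicOn I cov a b g) {t : ℝ}
    (ht : t ∈ Icc a b) :
    derivWithin (leftVelocity I a b g) (Icc a b) t +
      lieConnection cov (leftVelocity I a b g t) (leftVelocity I a b g t) = 0 := by
  have h := hg.covDerivAlong_velocity t ht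
  rw [EulerPoincare.covDerivAlong_velocity cov hab hg.contMDiffOn ht,
    velocity_eq_mulInvariantVectorField, cov_leftInvariant_self hinv hcov, ← Pi.add_apply,
    ← mulInvariantVectorField_add] at h
  set v := derivWithin (leftVelocity I a b g) (Icc a b) t +
    lieConnection cov (leftVelocity I a b g t) (leftVelocity I a b g t)
  have h0 := inner_leftInvariant hinv v v (g t)
  rw [h, inner_zero_left] at h0
  exact inner_self_eq_zero (𝕜 := ℝ) (E := TangentSpace I (1 : G)) |>.1 h0.symm

end Curve

end EulerPoincare

end

theorem theorem2p4
    {E : Type*} [NormedAddCommGroup E] [NormedSpace ℝ E] [FiniteDimensional ℝ E]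
    {H : Type*} [TopologicalSpace H] (I : ModelWithCorners ℝ E H) [I.Boundaryless]
    {G : Type*} [TopologicalSpace G] [ChartedSpace H G] [Group G] [LieGroup I ∞ G]
    [RiemannianBundle (fun x : G ↦ TangentSpace I x)]
    [IsContMDiffRiemannianBundle I ∞ E (fun x : G ↦ TangentSpace I x)]
    (hinv : EulerPoincare.IsLeftInvariantMetric I G)
    (cov : CovariantDerivative I E (TangentSpace I : G → Type _))
    (hcov : EulerPoincare.IsLeviCivita cov)
    (a b : ℝ) (hab : a < b) (g : ℝ → G)
    (hg : EulerPoincare.IsGeodesicOn I cov a b g) :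
    haveI : CompleteSpace E := FiniteDimensional.complete ℝ E
    let ξ : ℝ → GroupLieAlgebra I G := EulerPoincare.leftVelocity I a b g
    DifferentiableOn ℝ ξ (Icc a b) ∧
    (∀ t ∈ Icc a b,
      derivWithin ξ (Icc a b) t + EulerPoincare.lieConnection cov (ξ t) (ξ t) = 0) ∧
    (∀ t ∈ Icc a b,
      EulerPoincare.flat (derivWithin ξ (Icc a b) t) =
        EulerPoincare.coadMap (ξ t) (EulerPoincare.flat (ξ t))) ∧
    (∀ x v : GroupLieAlgebra I G,
      v + EulerPoincare.lieConnection cov x x = 0 ↔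
        EulerPoincare.flat v = EulerPoincare.coadMap x (EulerPoincare.flat x)) := by
  have hode := fun t (ht : t ∈ Icc a b) ↦ hg.euler_poincare hinv hcov hab ht
  exact ⟨EulerPoincare.differentiableOn_leftVelocity hab hg.contMDiffOn, hode,
    fun t ht ↦ (EulerPoincare.add_lieConnection_eq_zero_iff hinv hcov _ _).1 (hode t ht),
    EulerPoincare.add_lieConnection_eq_zero_iff hinv hcov⟩
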